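/- Let $F=\mathbb F_q$ be a finite field with $q$ elements and let $n\ge 0$. Let $B_q(n)$ be the set of all subspaces of $F^n$, put $(m)_q=1+q+\cdots+q^{m-1}$, and let $\mathbb C[B_q(n)]$ be the complex vector space with basis $B_q(n)$ (column vectors indexed by $B_q(n)$). Let $M_q(n)$ be the $B_q(n)\times B_q(n)$ matrix with $M_q(n)(X,Y)=1$ if $Y\subseteq X$ and $\dim Y=\dim X-1$, $M_q(n)(X,Y)=q^{\dim X}$ if $X\subseteq Y$ and $\dim Y=\dim X+1$, and $M_q(n)(X,Y)=0$ otherwise. Let $$\langle u,v\rangle_\pi=\sum_{X\in B_q(n)}\overline{u(X)}\,v(X)\,\pi(X),\qquad \pi(X)=\frac{q^{\binom{\dim X}{2}}}{\prod_{k=0}^{n-1}(1+q^k)}.$$ Identify $F^n$ with the vectors of $F^{n+1}$ whose last component is $0$, so that $B_q(n)\subseteq B_q(n+1)$. Let $e_{n+1}$ be the last standard basis vector of $F^{n+1}$. For $X\in B_q(n)$ put $\widehat X=X+Fe_{n+1}$, and let $\theta_n:\mathbb C[B_q(n)]\to\mathbb C[B_q(n+1)]$ be the linear map sending $X$ to the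 sum of all $Y\in B_q(n+1)$ that cover $X$ and are not contained in $F^n$. Let $H(n+1,F)\cong F^n$ be the group of the maps $g_a:x\mapsto x+x_{n+1}a$ of $F^{n+1}$, $a\in F^n$, let $\mathcal N_q(n)$ be the set of its nontrivial complex characters (of degree $1$), and for a character $\chi$ and $Z\in B_q(n+1)$ put $p(\chi)(Z)=\sum_{g\in H(n+1,F)}\overline{\chi(g)}\,gZ$. For $\chi\in\mathcal N_q(n)$ let $X(\chi)$ be the unique $(n-1)$-dimensional subspace $X$ of $F^n$ with $p(\chi)(\widehat X)\ne0$, and let $\tau_\chi:F^{n-1}\to X(\chi)$ be the isomorphism that sends $e_j$ to column $j$ of the unique $n\times(n-1)$ matrix in column reduced echelon form (the last nonzero entry of each column is a $1$, the rows of these entries are strictly increasing and form the identity matrix) whose column space is $X(\chi)$. Let $\Lambda_\chi:\mathbb C[B_q(n-1)]\to\mathbb C[B_q(n+1)]$ be the linear map $Y\mapsto q^{-\dim Y}p(\chi)\bigl(\widehat{\tau_\chi(Y)}\bigr)$. Let $\mathcal E_q(0)=\{()\}$, $\mathcal E_q(1)=\{(0),(1)\}$, and for $n\ge2$ let $\mathcal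 E_q(n)$ be the set of sequences obtained from a sequence in $\mathcal E_q(n-1)$ by appending $0$ or $1$, or from a sequence in $\mathcal E_q(n-2)$ by appending an element of $\mathcal N_q(n-1)$. Let $N(\alpha)$ be the number of nonzero entries of $\alpha$ (characters count as nonzero). Define $v_\alpha\in\mathbb C[B_q(n)]$ for $\alpha\in\mathcal E_q(n)$ inductively by $v_{()}=\{0\}$ (the basis element given by the zero subspace) and, for $\alpha\in\mathcal E_q(n+1)$ obtained by appending the entry $\alpha_t$ to $\beta$, with $k=N(\beta)$, $$v_\alpha=q^kv_\beta+\theta_n(v_\beta)\ \text{ if }\alpha_t=0,\qquad v_\alpha=q^{n-k}v_\beta-\theta_n(v_\beta)\ \text{ if }\alpha_t=1,\qquad v_\alpha=\Lambda_\chi(v_\beta)\ \text{ if }\alpha_t=\chi\in\mathcal N_q(n).$$ Then $\{v_\alpha:\alpha\in\mathcal E_q(n)\}$ is a basis of $\mathbb C[B_q(n)]$ consisting of eigenvectors of $M_q(n)$, with $$M_q(n)v_\alpha=\bigl((n-N(\alpha))_q-(N(\alpha))_q\bigr)v_\alpha,$$ and this basis is orthogonal: $\langle v_\alpha,v_{\alpha'}\rangle_\pi=0$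 for all $\alpha\ne\alpha'$ in $\mathcal E_q(n)$. -/

import Mathlib

universe u

noncomputable section

namespace QCube

/-- `B_q(n)`: the set of all subspaces of `F^n`, where `F` is the field with `q` elements. -/
abbrev B (F : Type u) [Field F] (n : ℕ) : Type u := Submodule F (Fin n → F)

instance instFintypeB (F : Type u) [Field F] [Fintype F] (n : ℕ) : Fintype (B F n) :=
  Fintype.ofFinite _

instance instDecidableEqB (F : Type u) [Field F] (n : ℕ) : DecidableEq (B F n) :=
  Classical.decEq _

/-- The order `q` of the field, as a complex number. -/
def q (F : Type u) [Fintype F] : ℂ := (Fintype.card F : ℂ)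

/-- `(m)_q = 1 + q + ⋯ + q^(m-1)`. -/
def qInt (F : Type u) [Fintype F] (m : ℕ) : ℂ := ∑ i ∈ Finset.range m, q F ^ i

/-- The space `ℂ[B_q(n)]`, as column vectors with components indexed by `B_q(n)`. -/
abbrev V (F : Type u) [Field F] (n : ℕ) : Type u := B F n → ℂ

/-- The element `X` of the standard basis of `ℂ[B_q(n)]`. -/
def vec {F : Type u} [Field F] {n : ℕ} (X : B F n) : V F n := Pi.single X 1

open Classical in
/-- The matrix `M_q(n)`. -/
def Mq (F : Type u) [Field F] [Fintype F] (n : ℕ) : Matrix (B F n) (B F n) ℂ :=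
  fun X Y =>
    if Y ≤ X ∧ Module.finrank F X = Module.finrank F Y + 1 then 1
    else if X ≤ Y ∧ Module.finrank F Y = Module.finrank F X + 1 then
      q F ^ Module.finrank F X
    else 0

/-- The weight `π(X) = q^(dim X choose 2) / ∏_{k<n} (1 + q^k)`. -/
def wt {F : Type u} [Field F] [Fintype F] {n : ℕ} (X : B F n) : ℂ :=
  q F ^ (Module.finrank F X).choose 2 / ∏ k ∈ Finset.range n, (1 + q F ^ k)

/-- The inner product `⟨u, v⟩_π = ∑_X conj (u X) * v X * π(X)`. -/
def innerPi {F : Type u} [Field F] [Fintype F] {n : ℕ} (u v : V F n) : ℂ :=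
  ∑ X : B F n, (starRingEnd ℂ) (u X) * v X * wt X

/-- The identification of `F^n` with the vectors in `F^(n+1)` whose last component is zero. -/
def emb (F : Type u) [Field F] (n : ℕ) : (Fin n → F) →ₗ[F] (Fin (n + 1) → F) where
  toFun x := Fin.snoc (α := fun _ => F) x 0
  map_add' x y := by
    ext i
    refine Fin.lastCases ?_ (fun j => ?_) i <;> simp
  map_smul' c x := by
    ext i
    refine Fin.lastCases ?_ (fun j => ?_) i <;> simp

/-- The inclusion of `ℂ[B_q(n)]` in `ℂ[B_q(n+1)]`. -/
def incl (F : Type u) [Field F] [Fintype F] (n : ℕ) : V F n →ₗ[ℂ] V F (n + 1) :=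
  Fintype.linearCombination ℂ fun X : B F n => vec (X.map (emb F n))

/-- `X` belongs to `A_q(n+1)`: it is not contained in the hyperplane `F^n`. -/
def IsA {F : Type u} [Field F] {n : ℕ} (X : B F (n + 1)) : Prop :=
  ¬ X ≤ LinearMap.range (emb F n)

open Classical in
/-- The map `θ_n`, sending `X` in `B_q(n)` to the sum of all `Y` in `A_q(n+1)` that cover `X`. -/
def theta (F : Type u) [Field F] [Fintype F] (n : ℕ) : V F n →ₗ[ℂ] V F (n + 1) :=
  Fintype.linearCombination ℂ fun X : B F n =>
    ∑ Y : B F (n + 1), if IsA Y ∧ X.map (emb F n) ⋖ Y then vec Y else 0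

/-- `X̂`, the span of `X` and the last standard basis vector `e_(n+1)`. -/
def hat {F : Type u} [Field F] {n : ℕ} (X : B F n) : B F (n + 1) :=
  X.map (emb F n) ⊔ Submodule.span F {Pi.single (Fin.last n) 1}

/-- The element of the group `H(n+1, F)` with last column `(a, 1)`, i.e. the linear map
`x ↦ x + x_(n+1) a` on `F^(n+1)`. The map `a ↦ shear a` is an isomorphism from the additive
group `F^n` onto `H(n+1, F)`; characters of `H(n+1, F)` are written as additive characters of
`F^n` through it. -/
def shear {F : Type u} [Field F] {n : ℕ} (a : Fin n → F) :
    (Fin (n + 1) → F) →ₗ[F] (Fin (n + 1) → F) :=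
  LinearMap.id + (LinearMap.proj (Fin.last n)).smulRight (emb F n a)

/-- `N_q(n)`: the nontrivial irreducible characters of `H(n+1, F) ≅ F^n`. -/
abbrev NChar (F : Type u) [Field F] (n : ℕ) : Type u :=
  {χ : AddChar (Fin n → F) ℂ // χ ≠ 1}

/-- `p(χ)(X) = ∑_g conj (χ g) • g X`, the sum over all `g` in `H(n+1, F)`. -/
def pChar {F : Type u} [Field F] [Fintype F] {n : ℕ} (χ : AddChar (Fin n → F) ℂ)
    (X : B F (n + 1)) : V F (n + 1) :=
  ∑ a : Fin n → F, (starRingEnd ℂ) (χ a) • vec (X.map (shear a))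

/-- `X(χ)`: the unique hyperplane `X` of `F^(n+1)` with `p(χ)(X̂) ≠ 0`, for a nontrivial `χ`. -/
def XChar {F : Type u} [Field F] [Fintype F] {n : ℕ} (χ : NChar F (n + 1)) : B F (n + 1) :=
  Classical.epsilon fun X : B F (n + 1) => Module.finrank F X = n ∧ pChar χ.1 (hat X) ≠ 0

/-- Schubert normal form (column reduced echelon form): `r j` is the row of the last nonzero
entry of column `j`, this entry is `1`, the `r j` increase, and the rows `r j` form the identity
matrix. -/
def IsSchubert {F : Type u} [Field F] {n k : ℕ} (M : Matrix (Fin n) (Fin k) F) : Prop :=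
  ∃ r : Fin k → Fin n, StrictMono r ∧
    (∀ j, ∀ i, r j < i → M i j = 0) ∧
    ∀ j j', M (r j) j' = if j = j' then 1 else 0

/-- The unique `n × k` matrix in Schubert normal form with column space `X`, where `X` has
dimension `k`. -/
def schubert {F : Type u} [Field F] {n : ℕ} (k : ℕ) (X : B F n) : Matrix (Fin n) (Fin k) F :=
  Classical.epsilon fun M => IsSchubert M ∧ LinearMap.range M.mulVecLin = X

/-- `λ(χ)(Y) = q^(-dim Y) p(χ)(Ŷ)`. -/
def lam {F : Type u} [Field F] [Fintype F] {n : ℕ} (χ : NChar F n) (Y : B F n) : V F (n + 1) :=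
  (q F ^ Module.finrank F Y)⁻¹ • pChar χ.1 (hat Y)

/-- The composition `λ(χ) μ(X(χ)) : ℂ[B_q(n)] → ℂ[B_q(n+2)]`, where `μ(X)` carries a subspace of
`F^n` to its image under the isomorphism `τ(X) : F^n → X` with `e_j ↦` column `j` of the Schubert
matrix of `X`. -/
def lamMu {F : Type u} [Field F] [Fintype F] {n : ℕ} (χ : NChar F (n + 1)) :
    V F n →ₗ[ℂ] V F (n + 2) :=
  Fintype.linearCombination ℂ fun Y : B F n =>
    lam χ (Y.map (schubert n (XChar χ)).mulVecLin)

/-- The index set `E_q(n)` of sequences: a sequence in `E_q(n)` is empty, or a sequence in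
`E_q(n-1)` followed by `0` or `1`, or a sequence in `E_q(n-2)` followed by an element of
`N_q(n-1)`. -/
inductive E (F : Type u) [Field F] : ℕ → Type u
  | nil : E F 0
  | zero {n : ℕ} (β : E F n) : E F (n + 1)
  | one {n : ℕ} (β : E F n) : E F (n + 1)
  | char {n : ℕ} (β : E F n) (χ : NChar F (n + 1)) : E F (n + 2)

/-- `N(α)`: the number of nonzero entries of `α`. -/
def E.N {F : Type u} [Field F] : {n : ℕ} → E F n → ℕ
  | _, .nil => 0
  | _, .zero β => β.N
  | _, .one β => β.N + 1
  | _, .char β _ => β.N + 1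

/-- `N(α) ≤ n`, so that the differences `n - N(α)` below are never truncated. -/
theorem E.N_le {F : Type u} [Field F] {n : ℕ} (α : E F n) : α.N ≤ n := by
  induction α with
  | nil => exact le_rfl
  | zero β ih => exact Nat.le_succ_of_le ih
  | one β ih => exact Nat.succ_le_succ ih
  | char β χ ih => exact Nat.le_succ_of_le (Nat.succ_le_succ ih)

/-- The vectors `v_α`. -/
def E.v {F : Type u} [Field F] [Fintype F] : {n : ℕ} → E F n → V F n
  | _, .nil => vec ⊥
  | _, .zero (n := n) β => q F ^ β.N • incl F n β.v + theta F n β.v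
  | _, .one (n := n) β => q F ^ (n - β.N) • incl F n β.v - theta F n β.v
  | _, .char β χ => lamMu χ β.v

end QCube

end

noncomputable section

namespace QCube

open Module ComplexConjugate

/-! ### Arithmetic of the `q`-integers. -/

section Scalars

variable (F : Type u) [Fintype F]

/-! A subspace of F^(n+1) either lies in F^n or is `slant a W`, with W in F^n unique and a unique
modulo W. Fourier analysis in a splits ℂ[B_q(n+1)] into the image of `incl` and the images of `twist
χ`, one for each character χ of F^n; `twist χ u` sees u only on subspaces where χ is trivial, and
`theta` is the twist by the trivial character (`theta_eq_twist`).

Let Mu = λu. By `mulVec_incl` and `mulVec_theta`, M sends `incl u` to λ `incl u` + `theta u` and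
`theta u` to q^n `incl u` + qλ `theta u`. For λ = (n-k)_q - (k)_q this 2 × 2 action has the
eigenvectors with coefficients (q^k, 1) and (q^(n-k), -1). For nontrivial χ, the subspaces where χ
is trivial are those of a hyperplane, a copy of F^(n-1); there M acts as on ℂ[B_q(n-1)] times q
(`mulVec_lamMu`), and qλ is again a difference of `q`-integers, with both indices raised by one.

Orthogonality comes from disjoint supports, from orthogonality of characters (`innerPi_twist_twist`)
and, for the two extensions of one β, from q^k q^(n-k) - q^n = 0. Nonzero norms then give
independence. Spanning is Fourier inversion (`vec_slant_eq_sum_twist`) with induction over two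
previous levels. -/

lemma one_add_q_pow_ne_zero (k : ℕ) : 1 + q F ^ k ≠ 0 := by
  unfold q
  exact_mod_cast (by omega : 1 + Fintype.card F ^ k ≠ 0)

lemma qInt_succ (m : ℕ) : qInt F (m + 1) = q F * qInt F m + 1 := by
  simp only [qInt, Finset.sum_range_succ', Finset.mul_sum, pow_succ', pow_zero]

lemma qInt_succ' (m : ℕ) : qInt F (m + 1) = qInt F m + q F ^ m := by
  simp only [qInt, Finset.sum_range_succ]

lemma conj_q : conj (q F) = q F := by simp [q]

end Scalars

/-! ### Subspaces of F^(n+1) relative to the hyperplane F^n. -/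

section Geometry

variable {F : Type u} [Field F] {n : ℕ}

@[simp] lemma emb_apply_castSucc (x : Fin n → F) (i : Fin n) : emb F n x i.castSucc = x i := by
  simp [emb]

@[simp] lemma emb_apply_last (x : Fin n → F) : emb F n x (Fin.last n) = 0 := by
  simp [emb]

@[simp] lemma init_emb (x : Fin n → F) : Fin.init (α := fun _ => F) (emb F n x) = x := by
  ext i; simp [Fin.init]

lemma emb_injective : Function.Injective (emb F n) := fun x y h => by
  rw [← init_emb x, h, init_emb]

lemma eq_emb_init_add (x : Fin (n + 1) → F) :
    x = emb F n (Fin.init x) + x (Fin.last n) • Pi.single (Fin.last n) 1 := by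
  ext i
  refine Fin.lastCases ?_ (fun j => ?_) i <;> simp [Fin.init]

lemma mem_map_emb {W : B F n} {x : Fin (n + 1) → F} :
    x ∈ W.map (emb F n) ↔ x (Fin.last n) = 0 ∧ Fin.init x ∈ W := by
  constructor
  · rintro ⟨y, hy, rfl⟩
    exact ⟨by simp, by simpa using hy⟩
  · rintro ⟨h0, h⟩
    refine ⟨_, h, ?_⟩
    conv_rhs => rw [eq_emb_init_add x, h0]
    simp

lemma mem_hat {W : B F n} {x : Fin (n + 1) → F} : x ∈ hat W ↔ Fin.init x ∈ W := by
  unfold hat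
  rw [Submodule.mem_sup]
  constructor
  · rintro ⟨y, hy, z, hz, rfl⟩
    obtain ⟨c, rfl⟩ := Submodule.mem_span_singleton.1 hz
    obtain ⟨y, hy, rfl⟩ := hy
    have : Fin.init (emb F n y + c • Pi.single (Fin.last n) 1) = y := by
      ext i
      simp [Fin.init]
    rwa [this]
  · intro h
    exact ⟨_, ⟨_, h, rfl⟩, _, Submodule.mem_span_singleton.2 ⟨_, rfl⟩, (eq_emb_init_add x).symm⟩

lemma shear_apply (a : Fin n → F) (x : Fin (n + 1) → F) :
    shear a x = x + x (Fin.last n) • emb F n a := by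
  simp [shear]

@[simp] lemma shear_apply_last (a : Fin n → F) (x : Fin (n + 1) → F) :
    shear a x (Fin.last n) = x (Fin.last n) := by
  simp [shear_apply]

lemma init_shear (a : Fin n → F) (x : Fin (n + 1) → F) :
    Fin.init (α := fun _ => F) (shear a x) = Fin.init x + x (Fin.last n) • a := by
  ext i; simp [shear_apply, Fin.init]

lemma shear_shear (a b : Fin n → F) (x : Fin (n + 1) → F) :
    shear a (shear b x) = shear (a + b) x := by
  rw [shear_apply, shear_apply_last, shear_apply, shear_apply, map_add, smul_add,
    add_comm (x (Fin.last n) • emb F n a), add_assoc]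

lemma shear_zero (x : Fin (n + 1) → F) : shear (0 : Fin n → F) x = x := by
  simp [shear_apply]

lemma shear_injective (a : Fin n → F) : Function.Injective (shear a) := fun x y h => by
  have := congrArg (shear (-a)) h
  simpa [shear_shear, shear_zero] using this

/-- The translate of `hat W` by `shear a`; these are the subspaces not contained in the
hyperplane `F^n`. -/
def slant (a : Fin n → F) (W : B F n) : B F (n + 1) := (hat W).map (shear a)

lemma mem_slant {a : Fin n → F} {W : B F n} {x : Fin (n + 1) → F} :
    x ∈ slant a W ↔ Fin.init x - x (Fin.last n) • a ∈ W := by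
  constructor
  · rintro ⟨y, hy, rfl⟩
    rw [init_shear, shear_apply_last, add_sub_cancel_right]
    exact mem_hat.1 hy
  · intro h
    refine ⟨shear (-a) x, mem_hat.2 ?_, by rw [shear_shear, add_neg_cancel, shear_zero]⟩
    rw [init_shear, smul_neg, ← sub_eq_add_neg]
    exact h

lemma emb_add_mem_slant (a : Fin n → F) (W : B F n) :
    emb F n a + Pi.single (Fin.last n) 1 ∈ slant a W := by
  rw [mem_slant]
  convert W.zero_mem
  ext i
  simp [Fin.init]

lemma isA_slant (a : Fin n → F) (W : B F n) : IsA (slant a W) := by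
  intro h
  obtain ⟨y, hy⟩ := h (emb_add_mem_slant a W)
  have := congrFun hy (Fin.last n)
  simp at this

lemma not_isA_map_emb (W : B F n) : ¬ IsA (W.map (emb F n)) :=
  not_not.2 LinearMap.map_le_range

lemma map_emb_injective : Function.Injective (fun W : B F n => W.map (emb F n)) :=
  Submodule.map_injective_of_injective emb_injective

lemma map_emb_le_map_emb {W W' : B F n} :
    W.map (emb F n) ≤ W'.map (emb F n) ↔ W ≤ W' :=
  Submodule.map_le_map_iff_of_injective emb_injective W W'

lemma map_emb_le_slant {a : Fin n → F} {W W' : B F n} :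
    W.map (emb F n) ≤ slant a W' ↔ W ≤ W' := by
  rw [Submodule.map_le_iff_le_comap]
  simp only [SetLike.le_def, Submodule.mem_comap, mem_slant, init_emb, emb_apply_last, zero_smul,
    sub_zero]

lemma not_slant_le_map_emb (a : Fin n → F) (W W' : B F n) : ¬ slant a W ≤ W'.map (emb F n) :=
  fun h => isA_slant a W (h.trans LinearMap.map_le_range)

lemma slant_ne_map_emb (a : Fin n → F) (W W' : B F n) : slant a W ≠ W'.map (emb F n) :=
  fun h => not_slant_le_map_emb a W W' h.le

lemma slant_le_slant {a b : Fin n → F} {W W' : B F n} :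
    slant a W ≤ slant b W' ↔ W ≤ W' ∧ a - b ∈ W' := by
  constructor
  · intro h
    refine ⟨map_emb_le_slant.1 ((map_emb_le_slant (a := a).2 le_rfl).trans h), ?_⟩
    have := mem_slant.1 (h (emb_add_mem_slant a W))
    convert this using 1
    ext i
    simp [Fin.init]
  · rintro ⟨h, hab⟩ x hx
    rw [mem_slant] at hx ⊢
    have := W'.add_mem (h hx) (W'.smul_mem (x (Fin.last n)) hab)
    rwa [smul_sub, sub_add_sub_cancel] at this

lemma slant_eq_slant {a b : Fin n → F} {W W' : B F n} :
    slant a W = slant b W' ↔ W = W' ∧ a - b ∈ W' := by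
  constructor
  · intro h
    have h1 := slant_le_slant.1 h.le
    exact ⟨h1.1.antisymm (slant_le_slant.1 h.ge).1, h1.2⟩
  · rintro ⟨rfl, h⟩
    exact (slant_le_slant.2 ⟨le_rfl, h⟩).antisymm
      (slant_le_slant.2 ⟨le_rfl, by rw [← neg_sub]; exact W.neg_mem h⟩)

/-- If X is not inside F^n, it contains a vector with last coordinate 1, say (a, 1); then X is
spanned by this vector and X ∩ F^n. -/
lemma eq_map_emb_or_eq_slant (X : B F (n + 1)) :
    (∃ W : B F n, X = W.map (emb F n)) ∨ ∃ (a : Fin n → F) (W : B F n), X = slant a W := by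
  by_cases hX : X ≤ LinearMap.range (emb F n)
  · exact .inl ⟨X.comap (emb F n), (Submodule.map_comap_eq_of_le hX).symm⟩
  · right
    obtain ⟨x, hx, hx'⟩ := SetLike.not_le_iff_exists.1 hX
    have h0 : x (Fin.last n) ≠ 0 := fun h0 => hx' ⟨Fin.init x, by
      conv_rhs => rw [eq_emb_init_add x, h0]
      simp⟩
    set c := x (Fin.last n)
    have hy : emb F n (c⁻¹ • Fin.init x) + Pi.single (Fin.last n) 1 ∈ X := by
      convert X.smul_mem c⁻¹ hx using 1
      conv_rhs => rw [eq_emb_init_add x]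
      rw [smul_add, map_smul, smul_smul, inv_mul_cancel₀ h0, one_smul]
    set a := c⁻¹ • Fin.init x
    refine ⟨a, X.comap (emb F n), ?_⟩
    ext z
    rw [mem_slant, Submodule.mem_comap]
    have : z = emb F n (Fin.init z - z (Fin.last n) • a) +
        z (Fin.last n) • (emb F n a + Pi.single (Fin.last n) 1) := by
      conv_lhs => rw [eq_emb_init_add z]
      rw [map_sub, map_smul, smul_add]
      abel
    conv_lhs => rw [this]
    exact Submodule.add_mem_iff_left _ (X.smul_mem _ hy)

@[simp] lemma finrank_map_emb (W : B F n) : finrank F (W.map (emb F n)) = finrank F W :=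
  (LinearEquiv.finrank_eq (Submodule.equivMapOfInjective _ emb_injective W)).symm

@[simp] lemma finrank_slant (a : Fin n → F) (W : B F n) :
    finrank F (slant a W) = finrank F W + 1 := by
  have h1 : finrank F (slant a W) = finrank F (hat W) :=
    (LinearEquiv.finrank_eq (Submodule.equivMapOfInjective _ (shear_injective a) (hat W))).symm
  have h2 := Submodule.finrank_sup_add_finrank_inf_eq (W.map (emb F n))
    (Submodule.span F {(Pi.single (Fin.last n) 1 : Fin (n + 1) → F)})
  have h3 : W.map (emb F n) ⊓
      Submodule.span F {(Pi.single (Fin.last n) 1 : Fin (n + 1) → F)} = ⊥ := by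
    rw [eq_bot_iff]
    rintro x ⟨hx, hx'⟩
    obtain ⟨c, rfl⟩ := Submodule.mem_span_singleton.1 hx'
    have := (mem_map_emb.1 hx).1
    simp at this
    simp [this]
  rw [h3, finrank_bot, finrank_map_emb, finrank_span_singleton (by simp)] at h2
  rw [h1]
  exact h2

/-- A character is trivial on the subspace `W`. -/
def Triv (χ : AddChar (Fin n → F) ℂ) (W : B F n) : Prop := ∀ x ∈ W, χ x = 1

lemma triv_one (W : B F n) : Triv (1 : AddChar (Fin n → F) ℂ) W := fun _ _ => rfl

lemma vec_apply {m : ℕ} (X Y : B F m) : vec X Y = if Y = X then 1 else 0 := by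
  simp [vec, Pi.single_apply]

lemma funext_subspaces {f g : V F (n + 1)}
    (h1 : ∀ W : B F n, f (W.map (emb F n)) = g (W.map (emb F n)))
    (h2 : ∀ (a : Fin n → F) (W : B F n), f (slant a W) = g (slant a W)) : f = g := by
  funext X
  obtain ⟨W, rfl⟩ | ⟨a, W, rfl⟩ := eq_map_emb_or_eq_slant X
  exacts [h1 W, h2 a W]

lemma covBy_iff_finrank {m : ℕ} {X Y : B F m} :
    X ⋖ Y ↔ X ≤ Y ∧ finrank F Y = finrank F X + 1 := by
  constructor
  · intro h
    refine ⟨h.le, ?_⟩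
    obtain ⟨y, hy, hyX⟩ := SetLike.exists_of_lt h.lt
    have hy0 : y ≠ 0 := fun h0 => hyX (h0 ▸ X.zero_mem)
    have h1 : X ⊔ Submodule.span F {y} = Y := by
      refine (h.eq_or_eq le_sup_left (sup_le h.le ?_)).resolve_left fun h' => hyX ?_
      · simpa using hy
      · rw [← h']
        exact Submodule.mem_sup_right (Submodule.mem_span_singleton_self y)
    have h2 := Submodule.finrank_add_le_finrank_add_finrank X (Submodule.span F {y})
    rw [h1, finrank_span_singleton hy0] at h2
    have := Submodule.finrank_lt_finrank_of_lt h.lt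
    omega
  · rintro ⟨h, hd⟩
    refine ⟨lt_of_le_of_ne h fun h' => ?_, fun Z hXZ hZY => ?_⟩
    · subst h'; omega
    · have h1 := Submodule.finrank_lt_finrank_of_lt hXZ
      have h2 := Submodule.finrank_lt_finrank_of_lt hZY
      omega

lemma finrank_map_of_injective {m : ℕ} {τ : (Fin n → F) →ₗ[F] (Fin m → F)}
    (hτ : Function.Injective τ) (Y : B F n) : finrank F (Y.map τ) = finrank F Y :=
  (LinearEquiv.finrank_eq (Submodule.equivMapOfInjective _ hτ Y)).symm

lemma map_emb_covBy_slant {W W' : B F n} {a : Fin n → F} :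
    W.map (emb F n) ⋖ slant a W' ↔ W = W' := by
  rw [covBy_iff_finrank, map_emb_le_slant, finrank_slant, finrank_map_emb]
  constructor
  · rintro ⟨h, hd⟩
    exact Submodule.eq_of_le_of_finrank_eq h (by omega)
  · rintro rfl
    exact ⟨le_rfl, rfl⟩

/-- Only existence for hyperplanes is needed. With p the first index where l(e_p) ≠ 0, the columns
are the e_i, i ≠ p, corrected by a multiple of e_p to lie in the kernel. -/
lemma exists_schubert {l : Dual F (Fin (n + 1) → F)} (hl : l ≠ 0) :
    ∃ M : Matrix (Fin (n + 1)) (Fin n) F, IsSchubert M ∧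
      LinearMap.range M.mulVecLin = LinearMap.ker l := by
  have hne : {i : Fin (n + 1) | l (Pi.single i 1) ≠ 0}.Nonempty := by
    by_contra h
    rw [Set.not_nonempty_iff_eq_empty, Set.eq_empty_iff_forall_notMem] at h
    refine hl ((Pi.basisFun F (Fin (n + 1))).ext fun i => ?_)
    simpa using h i
  obtain ⟨p, hp, hmin⟩ := wellFounded_lt.has_min _ hne
  replace hmin : ∀ i, i < p → l (Pi.single i 1) = 0 := fun i hi => by
    by_contra h
    exact hmin i h hi
  let c : Fin n → F := fun j => - l (Pi.single (p.succAbove j) 1) / l (Pi.single p 1)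
  let M : Matrix (Fin (n + 1)) (Fin n) F := fun i j =>
    (Pi.single (p.succAbove j) 1 + c j • Pi.single p 1 : Fin (n + 1) → F) i
  have hrow (j j') : M (p.succAbove j) j' = if j = j' then 1 else 0 := by
    simp [M, Pi.single_apply, Fin.succAbove_ne]
  have hM : IsSchubert M := by
    refine ⟨p.succAbove, Fin.strictMono_succAbove p, fun j i hi => ?_, hrow⟩
    by_cases hip : i = p
    -- An entry in row p below the pivot vanishes: the pivot index is then less than p, so l kills
    -- its basis vector by minimality.
    · subst hip
      simp [M, c, hmin _ hi]
    · simp [M, hip, hi.ne']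
  refine ⟨M, hM, Submodule.eq_of_le_of_finrank_eq ?_ ?_⟩
  · rw [LinearMap.range_le_ker_iff]
    refine (Pi.basisFun F (Fin n)).ext fun j => ?_
    have : M.mulVec (Pi.single j 1) = Pi.single (p.succAbove j) 1 + c j • Pi.single p 1 := by
      rw [Matrix.mulVec_single_one]
      rfl
    simp only [Pi.basisFun_apply, LinearMap.comp_apply, Matrix.mulVecLin_apply, this, map_add,
      map_smul, smul_eq_mul, LinearMap.zero_apply, c]
    rw [div_mul_cancel₀ _ hp, add_neg_cancel]
  · have hinj : Function.Injective M.mulVecLin := by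
      intro x y h
      ext j
      have := congrFun h (p.succAbove j)
      simpa [Matrix.mulVec, dotProduct, hrow] using this
    rw [LinearMap.finrank_range_of_inj hinj]
    have h1 := l.finrank_range_add_finrank_ker
    rw [LinearMap.range_eq_top.2 (LinearMap.surjective hl), finrank_top] at h1
    simp at h1 ⊢
    omega

end Geometry

/-! ### Sums over a subspace and over all subspaces of F^(n+1). -/

section Sums

variable {F : Type u} [Field F] [Fintype F] {n : ℕ}

lemma q_ne_zero : q F ≠ 0 := Nat.cast_ne_zero.2 Fintype.card_ne_zero

lemma sum_char_mem (χ : AddChar (Fin n → F) ℂ) (W : B F n) [Decidable (Triv χ W)]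
    [DecidablePred (· ∈ W)] :
    ∑ a : Fin n → F, (if a ∈ W then χ a else 0) =
      if Triv χ W then q F ^ finrank F W else 0 := by
  classical
  have h1 : ∑ a : Fin n → F, (if a ∈ W then χ a else 0) =
      ∑ a : W, χ.compAddMonoidHom W.subtype.toAddMonoidHom a := by
    rw [← Finset.sum_filter]
    exact (Finset.sum_subtype _ (by simp) _)
  rw [h1, AddChar.sum_eq_ite]
  have h2 : χ.compAddMonoidHom W.subtype.toAddMonoidHom = 0 ↔ Triv χ W := by
    constructor
    · intro h x hx
      exact DFunLike.congr_fun h ⟨x, hx⟩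
    · intro h
      ext x
      exact h _ x.2
  simp only [h2]
  rw [Module.card_eq_pow_finrank (K := F) (V := W), Nat.cast_pow, q]

lemma sum_mem (W : B F n) [DecidablePred (· ∈ W)] :
    ∑ a : Fin n → F, (if a ∈ W then (1 : ℂ) else 0) = q F ^ finrank F W := by
  classical
  have := sum_char_mem (1 : AddChar (Fin n → F) ℂ) W
  simpa [Triv] using this

lemma sum_sub_mem (W : B F n) (b : Fin n → F) [DecidablePred (· ∈ W)] :
    ∑ a : Fin n → F, (if a - b ∈ W then (1 : ℂ) else 0) = q F ^ finrank F W := by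
  rw [← sum_mem W]
  exact Fintype.sum_equiv (Equiv.subRight b) _ _ fun a => rfl

/-- As a runs over F^n, each `slant a W` occurs once for every element of a coset of W, hence the
factor q^(-dim W). -/
lemma sum_subspaces (f : B F (n + 1) → ℂ) :
    ∑ X, f X = ∑ W : B F n, f (W.map (emb F n)) +
      ∑ W : B F n, (q F ^ finrank F W)⁻¹ * ∑ a : Fin n → F, f (slant a W) := by
  classical
  have key (X : B F (n + 1)) : ∑ W : B F n, (if X = W.map (emb F n) then (1 : ℂ) else 0) +
      ∑ W : B F n, (q F ^ finrank F W)⁻¹ *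
        ∑ a : Fin n → F, (if X = slant a W then (1 : ℂ) else 0) = 1 := by
    obtain ⟨W₀, rfl⟩ | ⟨b, W₀, rfl⟩ := eq_map_emb_or_eq_slant X
    · simp [map_emb_injective.eq_iff, (slant_ne_map_emb _ _ _).symm]
    · simp only [slant_ne_map_emb, if_false, Finset.sum_const_zero, zero_add]
      rw [Finset.sum_eq_single W₀]
      · have : ∀ a, (slant b W₀ = slant a W₀) ↔ a - b ∈ W₀ := fun a => by
          rw [eq_comm, slant_eq_slant]; simp
        simp only [this, sum_sub_mem]
        exact inv_mul_cancel₀ (pow_ne_zero _ q_ne_zero)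
      · intro W _ hW
        simp [slant_eq_slant, hW.symm]
      · simp
  calc ∑ X, f X = ∑ X, f X * (∑ W : B F n, (if X = W.map (emb F n) then (1 : ℂ) else 0) +
      ∑ W : B F n, (q F ^ finrank F W)⁻¹ *
        ∑ a : Fin n → F, (if X = slant a W then (1 : ℂ) else 0)) :=
        Finset.sum_congr rfl fun X _ => by rw [key X, mul_one]
    _ = _ := by
      simp_rw [mul_add, Finset.sum_add_distrib]
      congr 1
      · simp_rw [Finset.mul_sum]
        rw [Finset.sum_comm]
        simp
      · simp_rw [Finset.mul_sum]
        rw [Finset.sum_comm]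
        refine Finset.sum_congr rfl fun W _ => ?_
        rw [Finset.sum_comm]
        refine Finset.sum_congr rfl fun a _ => ?_
        simp [mul_comm]

end Sums

/-! ### The twists by characters. -/

section Twist

variable {F : Type u} [Field F] [Fintype F] {n : ℕ}

open Classical in
lemma sum_coset_conj_char (χ : AddChar (Fin n → F) ℂ) (W : B F n) (b : Fin n → F) :
    ∑ a : Fin n → F, (if a - b ∈ W then conj (χ a) else 0) =
      conj (χ b) * if Triv χ W then q F ^ finrank F W else 0 := by
  rw [← sum_char_mem, Finset.mul_sum]
  -- The reflection a ↦ b - a turns the conjugate character into χ itself, up to the constant conj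
  -- (χ b).
  refine Fintype.sum_equiv (Equiv.subLeft b) _ _ fun a => ?_
  have h : b - a ∈ W ↔ a - b ∈ W := by rw [← neg_sub, W.neg_mem_iff]
  simp only [Equiv.subLeft_apply, h]
  split_ifs
  · rw [← AddChar.map_neg_eq_conj, ← AddChar.map_neg_eq_conj, ← AddChar.map_add_eq_mul]
    congr 1
    abel
  · simp

/-- The linear map with `W ↦ q^(-dim W) p(χ)(hat W)`, for an arbitrary character `χ`. -/
def twist (χ : AddChar (Fin n → F) ℂ) : V F n →ₗ[ℂ] V F (n + 1) :=
  Fintype.linearCombination ℂ fun W : B F n => (q F ^ finrank F W)⁻¹ • pChar χ (hat W)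

@[simp] lemma twist_map_emb (χ : AddChar (Fin n → F) ℂ) (u : V F n) (W : B F n) :
    twist χ u (W.map (emb F n)) = 0 := by
  simp only [twist, Fintype.linearCombination_apply, Finset.sum_apply, Pi.smul_apply, pChar,
    vec_apply]
  refine Finset.sum_eq_zero fun W' _ => ?_
  have h (a : Fin n → F) : ¬ (W.map (emb F n) = (hat W').map (shear a)) :=
    (slant_ne_map_emb a W' W).symm
  simp [h]

open Classical in
@[simp] lemma twist_slant (χ : AddChar (Fin n → F) ℂ) (u : V F n) (a : Fin n → F) (W : B F n) :
    twist χ u (slant a W) = conj (χ a) * if Triv χ W then u W else 0 := by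
  simp only [twist, Fintype.linearCombination_apply, Finset.sum_apply, Pi.smul_apply, pChar,
    vec_apply]
  have h (b : Fin n → F) (W' : B F n) :
      slant a W = (hat W').map (shear b) ↔ W = W' ∧ b - a ∈ W := by
    change slant a W = slant b W' ↔ _
    rw [eq_comm, slant_eq_slant, eq_comm]
  simp only [h]
  rw [Finset.sum_eq_single W]
  · have h2 := sum_coset_conj_char χ W a
    simp only [true_and, smul_eq_mul, mul_ite, mul_one, mul_zero]
    rw [h2]
    have := pow_ne_zero (finrank F W) (q_ne_zero (F := F))
    split_ifs
    · field_simp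
    · simp
  · intro W' _ hW
    simp [hW.symm]
  · simp

@[simp] lemma incl_map_emb (u : V F n) (W : B F n) : incl F n u (W.map (emb F n)) = u W := by
  simp [incl, Fintype.linearCombination_apply, vec_apply, map_emb_injective.eq_iff]

@[simp] lemma incl_slant (u : V F n) (a : Fin n → F) (W : B F n) :
    incl F n u (slant a W) = 0 := by
  simp [incl, Fintype.linearCombination_apply, vec_apply, slant_ne_map_emb]

/-- The covers of W outside F^n are exactly the subspaces `slant a W`, and the factor q^(-dim W) in
the twist makes each count once. -/
lemma theta_eq_twist : theta F n = twist (1 : AddChar (Fin n → F) ℂ) := by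
  classical
  refine LinearMap.ext fun u => ?_
  refine funext_subspaces (fun W => ?_) fun a W => ?_
  · rw [twist_map_emb]
    simp only [theta, Fintype.linearCombination_apply, Finset.sum_apply, Pi.smul_apply]
    refine Finset.sum_eq_zero fun W' _ => ?_
    rw [Finset.sum_eq_zero, smul_zero]
    intro Y _
    split_ifs with h
    · rw [vec_apply, if_neg]
      rintro rfl
      exact not_isA_map_emb W h.1
    · rfl
  · rw [twist_slant, if_pos (triv_one W)]
    simp only [theta, Fintype.linearCombination_apply, Finset.sum_apply, Pi.smul_apply]
    have h (W' : B F n) : ∑ Y : B F (n + 1),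
        (if IsA Y ∧ W'.map (emb F n) ⋖ Y then vec Y else (0 : V F (n + 1))) (slant a W) =
        if W' = W then 1 else 0 := by
      rw [Finset.sum_eq_single (slant a W)]
      · simp only [isA_slant, map_emb_covBy_slant, true_and]
        split_ifs <;> simp [vec_apply]
      · intro Y _ hY
        split_ifs
        · rw [vec_apply, if_neg hY.symm]
        · rfl
      · simp
    simp [h]

/-! ### Blocks of M_q(n+1) and its action on the pieces. -/

lemma Mq_map_emb_map_emb (W W' : B F n) :
    Mq F (n + 1) (W.map (emb F n)) (W'.map (emb F n)) = Mq F n W W' := by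
  classical
  simp [Mq, map_emb_le_map_emb]

lemma Mq_map_emb_slant (W W' : B F n) (a : Fin n → F) :
    Mq F (n + 1) (W.map (emb F n)) (slant a W') = if W = W' then q F ^ finrank F W else 0 := by
  classical
  have h := map_emb_covBy_slant (W := W) (W' := W') (a := a)
  rw [covBy_iff_finrank, finrank_map_emb] at h
  simp only [Mq, finrank_map_emb, h, not_slant_le_map_emb, false_and, if_false]

lemma Mq_slant_map_emb (W W' : B F n) (a : Fin n → F) :
    Mq F (n + 1) (slant a W) (W'.map (emb F n)) = if W = W' then 1 else 0 := by
  classical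
  have h := map_emb_covBy_slant (W := W') (W' := W) (a := a)
  rw [covBy_iff_finrank] at h
  simp only [Mq, h, not_slant_le_map_emb, false_and, if_false, eq_comm]

open Classical in
lemma Mq_slant_slant (W W' : B F n) (a b : Fin n → F) :
    Mq F (n + 1) (slant b W) (slant a W') =
      if W' ≤ W ∧ finrank F W = finrank F W' + 1 then if a - b ∈ W then 1 else 0
      else if W ≤ W' ∧ finrank F W' = finrank F W + 1 then
        if a - b ∈ W' then q F ^ (finrank F W + 1) else 0
      else 0 := by
  have h : b - a ∈ W' ↔ a - b ∈ W' := by rw [← neg_sub, W'.neg_mem_iff]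
  simp only [Mq, slant_le_slant, finrank_slant, h, add_left_inj]
  split_ifs <;> first | rfl | tauto

/-- The a that contribute form a coset of the larger of W, W'. If that is W, the sum vanishes unless
χ is trivial on W, and the ratio of coset sizes gives q. If it is W', then χ is trivial on W too,
and q comes from the entry q^(dim W + 1). -/
lemma sum_Mq_slant_slant (χ : AddChar (Fin n → F) ℂ) (W W' : B F n) (b : Fin n → F)
    (hW' : Triv χ W') [Decidable (Triv χ W)] :
    (q F ^ finrank F W')⁻¹ * ∑ a, Mq F (n + 1) (slant b W) (slant a W') * conj (χ a) =
      q F * (conj (χ b) * if Triv χ W then Mq F n W W' else 0) := by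
  classical
  have hq := q_ne_zero (F := F)
  simp only [Mq_slant_slant]
  simp only [Mq]
  by_cases h1 : W' ≤ W ∧ finrank F W = finrank F W' + 1
  · simp only [h1, if_true, and_self, ite_mul, one_mul, zero_mul]
    rw [sum_coset_conj_char, h1.2]
    split_ifs
    · field_simp
      ring
    · simp
  · simp only [h1, if_false]
    by_cases h2 : W ≤ W' ∧ finrank F W' = finrank F W + 1
    · have hW : Triv χ W := fun x hx => hW' x (h2.1 hx)
      have := sum_coset_conj_char χ W' b
      simp only [h2, if_true, and_self, hW, ite_mul, zero_mul]
      simp_rw [← mul_ite_zero]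
      rw [← Finset.mul_sum, this, if_pos hW', h2.2]
      field_simp
      ring
    · simp [h2]

lemma mulVec_incl (u : V F n) :
    (Mq F (n + 1)).mulVec (incl F n u) = incl F n ((Mq F n).mulVec u) + theta F n u := by
  classical
  rw [theta_eq_twist]
  refine funext_subspaces (fun W => ?_) fun a W => ?_ <;>
    simp [Matrix.mulVec, dotProduct, sum_subspaces, Mq_map_emb_map_emb, Mq_slant_map_emb, triv_one]

/-- The component in F^n carries the full sum of conj χ, so it survives only for trivial χ.
(`AddChar` writes the trivial character both as `0` and as `1`.) -/
lemma mulVec_twist (χ : AddChar (Fin n → F) ℂ) [Decidable (χ = 0)] (u : V F n)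
    (hu : ∀ W, u W ≠ 0 → Triv χ W) :
    (Mq F (n + 1)).mulVec (twist χ u) =
      (if χ = 0 then q F ^ n else 0) • incl F n u + q F • twist χ ((Mq F n).mulVec u) := by
  classical
  have hu' (W : B F n) : (if Triv χ W then u W else 0) = u W := by
    split_ifs with h
    · rfl
    · by_contra h'
      exact h (hu W (Ne.symm h'))
  refine funext_subspaces (fun W => ?_) fun b W => ?_
  · have h1 : ∑ a, conj (χ a) = if χ = 0 then q F ^ n else 0 := by
      rw [← map_sum, AddChar.sum_eq_ite]
      split_ifs <;> simp [q]
    have hq := pow_ne_zero (finrank F W) (q_ne_zero (F := F))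
    simp only [Matrix.mulVec, dotProduct, sum_subspaces, Mq_map_emb_slant, twist_map_emb,
      twist_slant, hu', Pi.add_apply, Pi.smul_apply, incl_map_emb, smul_zero, add_zero, mul_zero,
      Finset.sum_const_zero, zero_add]
    rw [Finset.sum_eq_single W]
    · rw [← h1]
      simp only [if_true, ← Finset.mul_sum, ← Finset.sum_mul, smul_eq_mul]
      field_simp
    · intro W' _ h
      simp [h.symm]
    · simp
  · simp only [Matrix.mulVec, dotProduct, sum_subspaces, twist_map_emb,
      twist_slant, hu', Pi.add_apply, Pi.smul_apply, incl_slant, mul_zero,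
      Finset.sum_const_zero, zero_add, smul_eq_mul]
    have h (W' : B F n) : (q F ^ finrank F W')⁻¹ *
        ∑ a, Mq F (n + 1) (slant b W) (slant a W') * (conj (χ a) * u W') =
        q F * (conj (χ b) * if Triv χ W then Mq F n W W' * u W' else 0) := by
      simp_rw [← mul_assoc]
      rw [← Finset.sum_mul]
      by_cases h0 : u W' = 0
      · simp [h0]
      · rw [← mul_assoc, sum_Mq_slant_slant χ W W' b (hu W' h0), ← ite_zero_mul]
        ring
    simp_rw [h, ← Finset.mul_sum]
    split_ifs <;> simp

end Twist

/-! ### The inner product on the pieces. -/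

section Inner

variable {F : Type u} [Field F] [Fintype F] {n : ℕ}

lemma wt_eq_of_finrank_eq {W : B F n} {X : B F (n + 1)} (h : finrank F X = finrank F W) :
    wt X = wt W / (1 + q F ^ n) := by
  rw [wt, wt, h, Finset.prod_range_succ, div_div]

/-- The increment d of binom(d, 2) contributes q^d, which cancels the q^(-d) of `sum_subspaces`;
this is why the weight suits the decomposition. -/
lemma wt_slant (a : Fin n → F) (W : B F n) :
    wt (slant a W) = q F ^ finrank F W * (wt W / (1 + q F ^ n)) := by
  rw [wt, wt, finrank_slant, Finset.prod_range_succ, Nat.choose_succ_succ, Nat.choose_one_right,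
    pow_add, div_div, mul_div_assoc]

lemma innerPi_incl_incl (u v : V F n) :
    innerPi (incl F n u) (incl F n v) = innerPi u v / (1 + q F ^ n) := by
  simp only [innerPi, sum_subspaces, incl_map_emb, incl_slant, mul_zero, zero_mul,
    Finset.sum_const_zero, add_zero, Finset.sum_div]
  refine Finset.sum_congr rfl fun W _ => ?_
  rw [wt_eq_of_finrank_eq (finrank_map_emb W), mul_div_assoc]

lemma innerPi_incl_twist (χ : AddChar (Fin n → F) ℂ) (u v : V F n) :
    innerPi (incl F n u) (twist χ v) = 0 := by
  simp only [innerPi, sum_subspaces, incl_slant, twist_map_emb, map_zero, mul_zero, zero_mul,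
    Finset.sum_const_zero, add_zero]

lemma innerPi_twist_incl (χ : AddChar (Fin n → F) ℂ) (u v : V F n) :
    innerPi (twist χ v) (incl F n u) = 0 := by
  simp only [innerPi, sum_subspaces, incl_slant, twist_map_emb, map_zero, mul_zero, zero_mul,
    Finset.sum_const_zero, add_zero]

lemma sum_char_mul_conj (χ χ' : AddChar (Fin n → F) ℂ) [Decidable (χ = χ')] :
    ∑ a, χ a * conj (χ' a) = if χ = χ' then q F ^ n else 0 := by
  classical
  have h (a : Fin n → F) : χ a * conj (χ' a) = (χ - χ') a := by
    rw [AddChar.sub_apply, AddChar.map_neg_eq_conj]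
  simp_rw [h]
  rw [AddChar.sum_eq_ite]
  simp [sub_eq_zero, q]

lemma innerPi_twist_twist (χ χ' : AddChar (Fin n → F) ℂ) [Decidable (χ = χ')] (u v : V F n)
    (hu : ∀ W, u W ≠ 0 → Triv χ W) :
    innerPi (twist χ u) (twist χ' v) =
      if χ = χ' then q F ^ n / (1 + q F ^ n) * innerPi u v else 0 := by
  classical
  have hq := q_ne_zero (F := F)
  simp only [innerPi, sum_subspaces, twist_map_emb, map_zero, mul_zero, zero_mul,
    Finset.sum_const_zero, zero_add, twist_slant, wt_slant, map_mul, Complex.conj_conj]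
  have h (W : B F n) : (q F ^ finrank F W)⁻¹ * ∑ a, χ a * conj (if Triv χ W then u W else 0) *
      (conj (χ' a) * if Triv χ' W then v W else 0) *
        (q F ^ finrank F W * (wt W / (1 + q F ^ n))) =
      (∑ a, χ a * conj (χ' a)) * (conj (u W) * (if Triv χ' W then v W else 0) * wt W /
        (1 + q F ^ n)) := by
    have h0 : (if Triv χ W then u W else 0) = u W := by
      split_ifs with h
      · rfl
      · by_contra h'
        exact h (hu W (Ne.symm h'))
    rw [h0, Finset.mul_sum, Finset.sum_mul]
    refine Finset.sum_congr rfl fun a _ => ?_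
    field_simp
  simp_rw [h, sum_char_mul_conj]
  split_ifs with hχ
  · subst hχ
    rw [Finset.mul_sum]
    refine Finset.sum_congr rfl fun W _ => ?_
    by_cases h0 : u W = 0
    · simp [h0]
    · rw [if_pos (hu W h0)]
      ring
  · simp

end Inner

/-! ### Transport along an injective linear map. -/

section Push

variable {F : Type u} [Field F] [Fintype F] {n m : ℕ}

/-- The linear map on subspaces induced by a linear map on vectors. -/
def push (τ : (Fin n → F) →ₗ[F] (Fin m → F)) : V F n →ₗ[ℂ] V F m :=
  Fintype.linearCombination ℂ fun Y : B F n => vec (Y.map τ)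

variable {τ : (Fin n → F) →ₗ[F] (Fin m → F)} (hτ : Function.Injective τ)

lemma push_vec (Y : B F n) : push τ (vec Y) = vec (Y.map τ) := by
  simp [push, vec, Fintype.linearCombination_apply_single]

include hτ in
lemma push_map (v : V F n) (Y : B F n) : push τ v (Y.map τ) = v Y := by
  simp [push, Fintype.linearCombination_apply, vec_apply,
    (Submodule.map_injective_of_injective hτ).eq_iff]

lemma le_range_of_push_ne_zero {v : V F n} {X : B F m} (h : push τ v X ≠ 0) :
    X ≤ LinearMap.range τ := by
  contrapose! h
  simp only [push, Fintype.linearCombination_apply, Finset.sum_apply, Pi.smul_apply, vec_apply]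
  refine Finset.sum_eq_zero fun Y _ => ?_
  rw [if_neg, smul_zero]
  rintro rfl
  exact h LinearMap.map_le_range

include hτ in
lemma sum_mul_push (f : B F m → ℂ) (v : V F n) :
    ∑ X, f X * push τ v X = ∑ Y : B F n, f (Y.map τ) * v Y := by
  refine (Fintype.sum_of_injective _ (Submodule.map_injective_of_injective hτ) _ _
    (fun X hX => ?_) fun Y => ?_).symm
  · by_contra h
    exact hX ⟨X.comap τ, Submodule.map_comap_eq_of_le
      (le_range_of_push_ne_zero (right_ne_zero_of_mul h))⟩
  · rw [push_map hτ]

include hτ in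
-- Valid only at subspaces of the range: outside it, M applied to the pushed vector may be nonzero.
lemma Mq_mulVec_push (v : V F n) (Y : B F n) :
    (Mq F m).mulVec (push τ v) (Y.map τ) = (Mq F n).mulVec v Y := by
  classical
  simp only [Matrix.mulVec, dotProduct]
  rw [sum_mul_push hτ (fun X => Mq F m (Y.map τ) X)]
  refine Finset.sum_congr rfl fun Z _ => ?_
  simp only [Mq, finrank_map_of_injective hτ, Submodule.map_le_map_iff_of_injective hτ]

end Push

lemma innerPi_push {F : Type u} [Field F] [Fintype F] {n : ℕ}
    {τ : (Fin n → F) →ₗ[F] (Fin (n + 1) → F)} (hτ : Function.Injective τ) (u v : V F n) :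
    innerPi (push τ u) (push τ v) = innerPi u v / (1 + q F ^ n) := by
  have h (X : B F (n + 1)) : conj (push τ u X) * push τ v X * wt X =
    conj (push τ u X) * wt X * push τ v X := by ring
  simp only [innerPi, h]
  rw [sum_mul_push hτ (fun X => conj (push τ u X) * wt X), Finset.sum_div]
  refine Finset.sum_congr rfl fun Y _ => ?_
  rw [push_map hτ, wt_eq_of_finrank_eq (finrank_map_of_injective hτ Y)]
  ring

/-! ### Nontrivial characters and their hyperplanes. -/

section Characters

variable {F : Type u} [Field F] [Fintype F] {n : ℕ}

lemma twist_vec (χ : AddChar (Fin n → F) ℂ) (W : B F n) :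
    twist χ (vec W) = (q F ^ finrank F W)⁻¹ • pChar χ (hat W) := by
  simp [twist, vec, Fintype.linearCombination_apply_single]

lemma twist_vec_ne_zero_iff (χ : AddChar (Fin n → F) ℂ) (W : B F n) :
    twist χ (vec W) ≠ 0 ↔ Triv χ W := by
  classical
  constructor
  · intro h
    by_contra hW
    refine h (funext_subspaces (fun X => by simp) fun a X => ?_)
    rw [twist_slant, vec_apply]
    have : ¬ (Triv χ X ∧ X = W) := fun h => hW (h.2 ▸ h.1)
    rw [← ite_and, if_neg this, mul_zero, Pi.zero_apply]
  · intro h h0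
    have := congrFun h0 (slant 0 W)
    simp [h, vec_apply] at this

lemma pChar_hat_ne_zero_iff (χ : AddChar (Fin n → F) ℂ) (W : B F n) :
    pChar χ (hat W) ≠ 0 ↔ Triv χ W := by
  rw [← twist_vec_ne_zero_iff, twist_vec,
    smul_ne_zero_iff_right (inv_ne_zero (pow_ne_zero _ q_ne_zero))]

/-- Fix ψ on F with ψ(1) ≠ 1. The map l ↦ ψ ∘ l from functionals to characters is injective, hence
bijective by counting. As W is closed under scaling, ψ ∘ l is trivial on W only if l vanishes there.
-/
lemma exists_dual_triv_iff {χ : AddChar (Fin n → F) ℂ} (hχ : χ ≠ 1) :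
    ∃ l : Dual F (Fin n → F), l ≠ 0 ∧ ∀ W, Triv χ W ↔ W ≤ LinearMap.ker l := by
  obtain ⟨ψ, hψ⟩ := AddChar.exists_apply_ne_zero.2 (one_ne_zero (α := F))
  have hker {y : F} (h : ∀ c : F, ψ (c * y) = 1) : y = 0 := by
    by_contra hy
    exact hψ (by simpa [hy] using h y⁻¹)
  have hinj : Function.Injective fun l : Dual F (Fin n → F) =>
      ψ.compAddMonoidHom l.toAddMonoidHom := by
    intro l l' h
    refine LinearMap.ext fun x => sub_eq_zero.1 (hker fun c => ?_)
    have h1 : ψ (l (c • x)) = ψ (l' (c • x)) := DFunLike.congr_fun h (c • x)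
    rw [mul_sub, AddChar.map_sub_eq_div, ← smul_eq_mul, ← smul_eq_mul, ← map_smul, ← map_smul, h1,
      div_self (ψ.val_isUnit _).ne_zero]
  have hcard : Nat.card (AddChar (Fin n → F) ℂ) ≤ Nat.card (Dual F (Fin n → F)) := by
    rw [Nat.card_eq_fintype_card, AddChar.card_eq, ← Nat.card_eq_fintype_card,
      Module.natCard_eq_pow_finrank (K := F) (V := Fin n → F),
      Module.natCard_eq_pow_finrank (K := F) (V := Dual F (Fin n → F)), Subspace.dual_finrank_eq]
  have : Finite (Dual F (Fin n → F)) := Module.finite_of_finite F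
  obtain ⟨l, rfl⟩ := (hinj.bijective_of_nat_card_le hcard).2 χ
  refine ⟨l, ?_, fun W => ⟨fun h x hx => hker fun c => ?_, fun h x hx => ?_⟩⟩
  · rintro rfl
    exact hχ (by ext x; simp)
  · have := h _ (W.smul_mem c hx)
    simpa using this
  · have := h hx
    simp only [LinearMap.mem_ker] at this
    simp [this]

lemma XChar_spec (χ : NChar F (n + 1)) :
    ∃ l : Dual F (Fin (n + 1) → F), l ≠ 0 ∧ XChar χ = LinearMap.ker l ∧
      ∀ W, Triv χ.1 W ↔ W ≤ LinearMap.ker l := by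
  obtain ⟨l, hl, h⟩ := exists_dual_triv_iff χ.2
  refine ⟨l, hl, ?_, h⟩
  have hfin : finrank F (LinearMap.ker l) = n := by
    have h1 := l.finrank_range_add_finrank_ker
    rw [LinearMap.range_eq_top.2 (LinearMap.surjective hl), finrank_top] at h1
    simp at h1
    omega
  have hex : ∃ X : B F (n + 1), finrank F X = n ∧ pChar χ.1 (hat X) ≠ 0 :=
    ⟨_, hfin, (pChar_hat_ne_zero_iff _ _).2 ((h _).2 le_rfl)⟩
  have hX := Classical.epsilon_spec hex
  exact Submodule.eq_of_le_of_finrank_eq ((h _).1 ((pChar_hat_ne_zero_iff _ _).1 hX.2))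
    (hX.1.trans hfin.symm)

/-- The embedding `τ(X(χ))` of `F^n` in `F^(n+1)`. -/
def tau (χ : NChar F (n + 1)) : (Fin n → F) →ₗ[F] (Fin (n + 1) → F) :=
  (schubert n (XChar χ)).mulVecLin

lemma tau_spec (χ : NChar F (n + 1)) :
    Function.Injective (tau χ) ∧ ∀ W, Triv χ.1 W ↔ W ≤ LinearMap.range (tau χ) := by
  obtain ⟨l, hl, hX, h⟩ := XChar_spec χ
  have hex := exists_schubert hl
  rw [← hX] at hex
  obtain ⟨⟨r, -, -, hr⟩, hrange⟩ := Classical.epsilon_spec hex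
  refine ⟨fun x y hxy => ?_, fun W => ?_⟩
  · ext j
    have := congrFun hxy (r j)
    simp only [tau, schubert, Matrix.mulVecLin_apply, Matrix.mulVec, dotProduct, hr] at this
    simpa using this
  · rw [h, ← hX, ← hrange]
    rfl

lemma lamMu_eq (χ : NChar F (n + 1)) (v : V F n) :
    lamMu χ v = twist χ.1 (push (tau χ) v) := by
  simp only [lamMu, push, Fintype.linearCombination_apply, map_sum, map_smul, twist_vec, lam, tau]

lemma triv_of_push_ne_zero (χ : NChar F (n + 1)) (v : V F n) (W : B F (n + 1))
    (h : push (tau χ) v W ≠ 0) : Triv χ.1 W :=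
  ((tau_spec χ).2 W).2 (le_range_of_push_ne_zero h)

lemma mulVec_lamMu (χ : NChar F (n + 1)) (v : V F n) :
    (Mq F (n + 2)).mulVec (lamMu χ v) = q F • lamMu χ ((Mq F n).mulVec v) := by
  classical
  rw [lamMu_eq, lamMu_eq, mulVec_twist _ _ (triv_of_push_ne_zero χ v), if_neg (show χ.1 ≠ 0 from χ.2), zero_smul,
    zero_add]
  congr 1
  -- M and `push` agree only on subspaces of the range, but the twist discards all others, where χ
  -- is nontrivial.
  refine funext_subspaces (fun W => by simp) fun a W => ?_
  rw [twist_slant, twist_slant]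
  split_ifs with hW
  · have hW' := Submodule.map_comap_eq_of_le (((tau_spec χ).2 W).1 hW)
    rw [← hW', Mq_mulVec_push (tau_spec χ).1, push_map (tau_spec χ).1]
  · rfl

lemma innerPi_lamMu_lamMu (χ χ' : NChar F (n + 1)) [Decidable (χ = χ')] (u v : V F n) :
    innerPi (lamMu χ u) (lamMu χ' v) =
      if χ = χ' then q F ^ (n + 1) / ((1 + q F ^ (n + 1)) * (1 + q F ^ n)) * innerPi u v
      else 0 := by
  classical
  rw [lamMu_eq, lamMu_eq, innerPi_twist_twist _ _ _ _ (triv_of_push_ne_zero χ u)]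
  simp only [← Subtype.ext_iff]
  split_ifs with h
  · subst h
    rw [innerPi_push (tau_spec χ).1, div_mul_div_comm, mul_div_right_comm]
  · rfl

/-- Fourier inversion on F^n: summing χ(a - b) over all χ isolates b = a. -/
lemma vec_slant_eq_sum_twist (a : Fin n → F) (W : B F n) :
    vec (slant a W) = (q F ^ finrank F W / q F ^ n) •
      ∑ χ : AddChar (Fin n → F) ℂ, χ a • twist χ (vec W) := by
  have hq := q_ne_zero (F := F)
  simp_rw [twist_vec, smul_comm _ ((q F ^ finrank F W)⁻¹), ← Finset.smul_sum, smul_smul, pChar,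
    Finset.smul_sum]
  rw [Finset.sum_comm]
  have h (b : Fin n → F) (χ : AddChar (Fin n → F) ℂ) : χ a * conj (χ b) = χ (a - b) := by
    rw [← AddChar.map_neg_eq_conj, ← AddChar.map_add_eq_mul, sub_eq_add_neg]
  simp only [smul_smul, mul_assoc, h, ← Finset.mul_sum, ← Finset.sum_smul]
  classical
  simp only [AddChar.sum_apply_eq_ite, sub_eq_zero, mul_ite, mul_zero, ite_smul, zero_smul,
    Finset.sum_ite_eq, Finset.mem_univ, if_true]
  change vec (slant a W) = _ • vec (slant a W)
  rw [Fintype.card_fun, Fintype.card_fin, Nat.cast_pow, ← q]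
  have : q F ^ finrank F W / q F ^ n * ((q F ^ finrank F W)⁻¹ * q F ^ n) = 1 := by field_simp
  rw [this, one_smul]

end Characters

/-! ### Eigenvalues. -/

section Eigenbasis

variable {F : Type u} [Field F] [Fintype F] {n : ℕ}

lemma mulVec_theta (u : V F n) :
    (Mq F (n + 1)).mulVec (theta F n u) =
      q F ^ n • incl F n u + q F • theta F n ((Mq F n).mulVec u) := by
  classical
  rw [theta_eq_twist, mulVec_twist _ _ fun W _ => triv_one W, if_pos AddChar.one_eq_zero]

/-- The eigenvalue of `v_α`. -/
def E.ev (α : E F n) : ℂ := qInt F (n - α.N) - qInt F α.N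

theorem mulVec_v (α : E F n) : (Mq F n).mulVec α.v = α.ev • α.v := by
  induction α with
  | nil =>
    have h (X : B F 0) : X = ⊥ := Subsingleton.elim _ _
    have hd (X : B F 0) : finrank F X = 0 := by rw [h X, finrank_bot]
    ext X
    simp [Matrix.mulVec, dotProduct, E.v, E.ev, E.N, vec_apply, Mq, hd]
  | @zero n β ih =>
    obtain ⟨m, hm⟩ := Nat.exists_eq_add_of_le β.N_le
    have h1 : n - β.N = m := by omega
    have h2 : n + 1 - β.N = m + 1 := by omega
    simp only [E.v, E.ev, E.N, Matrix.mulVec_add, Matrix.mulVec_smul, mulVec_incl, mulVec_theta, ih,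
      h1, h2, map_smul]
    generalize β.N = k at hm ⊢
    have e1 := qInt_succ F m
    have e2 := qInt_succ' F m
    have e3 := qInt_succ F k
    have e4 := qInt_succ' F k
    -- The coefficients of `incl` and `theta` are compared; both identities follow by expanding
    -- (j+1)_q as q (j)_q + 1 and as (j)_q + q^j.
    match_scalars
    · rw [hm, pow_add]
      linear_combination (-q F ^ k) * e2
    · linear_combination -e1 + e3 - e4
  | @one n β ih =>
    obtain ⟨m, hm⟩ := Nat.exists_eq_add_of_le β.N_le
    have h1 : n - β.N = m := by omega
    have h2 : n + 1 - (β.N + 1) = m := by omega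
    simp only [E.v, E.ev, E.N, Matrix.mulVec_sub, Matrix.mulVec_smul, mulVec_incl, mulVec_theta, ih,
      h1, h2, map_smul]
    generalize β.N = k at hm ⊢
    have e1 := qInt_succ F m
    have e2 := qInt_succ' F m
    have e3 := qInt_succ F k
    have e4 := qInt_succ' F k
    match_scalars
    · rw [hm, pow_add]
      linear_combination q F ^ m * e4
    · linear_combination e1 - e2 - e3
  | @char n β χ ih =>
    have h2 : n + 2 - (β.N + 1) = n - β.N + 1 := by have := β.N_le; omega
    simp only [E.v, E.ev, E.N, mulVec_lamMu, ih, map_smul, smul_smul, h2, qInt_succ]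
    congr 1
    ring

/-! ### Orthogonality and linear independence. -/

lemma innerPi_add_left {m : ℕ} (u v w : V F m) :
    innerPi (u + v) w = innerPi u w + innerPi v w := by
  simp [innerPi, add_mul, Finset.sum_add_distrib]

lemma innerPi_add_right {m : ℕ} (u v w : V F m) :
    innerPi u (v + w) = innerPi u v + innerPi u w := by
  simp [innerPi, mul_add, add_mul, Finset.sum_add_distrib]

lemma innerPi_smul_left {m : ℕ} (c : ℂ) (u v : V F m) :
    innerPi (c • u) v = conj c * innerPi u v := by
  simp [innerPi, Finset.mul_sum, mul_assoc]

lemma innerPi_smul_right {m : ℕ} (c : ℂ) (u v : V F m) :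
    innerPi u (c • v) = c * innerPi u v := by
  simp only [innerPi, Finset.mul_sum, Pi.smul_apply, smul_eq_mul]
  exact Finset.sum_congr rfl fun X _ => by ring

lemma innerPi_combination (a b a' b' : ℂ) (u v : V F n) :
    innerPi (a • incl F n u + b • theta F n u) (a' • incl F n v + b' • theta F n v) =
      (conj a * a' + conj b * b' * q F ^ n) / (1 + q F ^ n) * innerPi u v := by
  classical
  simp only [theta_eq_twist, innerPi_add_left, innerPi_add_right, innerPi_smul_left,
    innerPi_smul_right, innerPi_incl_incl, innerPi_incl_twist, innerPi_twist_incl]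
  rw [innerPi_twist_twist _ _ _ _ fun W _ => triv_one W, if_pos rfl]
  ring

lemma innerPi_combination_lamMu (a b : ℂ) (u : V F (n + 1)) (χ : NChar F (n + 1)) (v : V F n) :
    innerPi (a • incl F (n + 1) u + b • theta F (n + 1) u) (lamMu χ v) = 0 := by
  classical
  simp only [theta_eq_twist, lamMu_eq, innerPi_add_left, innerPi_smul_left, innerPi_incl_twist]
  rw [innerPi_twist_twist _ _ _ _ fun W _ => triv_one W, if_neg χ.2.symm]
  ring

lemma innerPi_lamMu_combination (a b : ℂ) (u : V F (n + 1)) (χ : NChar F (n + 1)) (v : V F n) :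
    innerPi (lamMu χ v) (a • incl F (n + 1) u + b • theta F (n + 1) u) = 0 := by
  classical
  simp only [theta_eq_twist, lamMu_eq, innerPi_add_right, innerPi_smul_right, innerPi_twist_incl]
  rw [innerPi_twist_twist _ _ _ _ (triv_of_push_ne_zero χ v), if_neg χ.2]
  ring

lemma v_zero (β : E F n) :
    (E.zero β).v = q F ^ β.N • incl F n β.v + (1 : ℂ) • theta F n β.v := by
  simp [E.v]

lemma v_one (β : E F n) :
    (E.one β).v = q F ^ (n - β.N) • incl F n β.v + (-1 : ℂ) • theta F n β.v := by
  simp [E.v, sub_eq_add_neg]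

theorem innerPi_v_self_ne_zero (α : E F n) : innerPi α.v α.v ≠ 0 := by
  classical
  have hsum (i j : ℕ) : q F ^ i + q F ^ j ≠ 0 := by
    have := Fintype.card_pos (α := F)
    unfold q
    exact_mod_cast (by positivity : Fintype.card F ^ i + Fintype.card F ^ j ≠ 0)
  induction α with
  | nil =>
    have h (X : B F 0) : X = ⊥ := Subsingleton.elim _ _
    simp [innerPi, E.v, vec_apply, wt, h]
  | @zero n β ih =>
    rw [v_zero, innerPi_combination]
    refine mul_ne_zero (div_ne_zero ?_ (one_add_q_pow_ne_zero F n)) ih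
    simpa [conj_q F, ← pow_add] using hsum _ _
  | @one n β ih =>
    rw [v_one, innerPi_combination]
    refine mul_ne_zero (div_ne_zero ?_ (one_add_q_pow_ne_zero F n)) ih
    simpa [conj_q F, ← pow_add] using hsum _ _
  | @char n β χ ih =>
    rw [E.v, innerPi_lamMu_lamMu, if_pos rfl]
    exact mul_ne_zero (div_ne_zero (pow_ne_zero _ q_ne_zero)
      (mul_ne_zero (one_add_q_pow_ne_zero F _) (one_add_q_pow_ne_zero F _))) ih

theorem innerPi_v_v (α α' : E F n) (h : α ≠ α') : innerPi α.v α'.v = 0 := by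
  classical
  induction α with
  | nil => cases α'; exact absurd rfl h
  | @zero n β ih =>
    cases α' with
    | zero β' =>
      rw [v_zero, v_zero, innerPi_combination, ih β' fun h' => h (h' ▸ rfl), mul_zero]
    | one β' =>
      rw [v_zero, v_one, innerPi_combination]
      by_cases h' : β = β'
      · subst h'
        -- The `incl` parts give q^k q^(n-k) = q^n, the `theta` parts give -q^n.
        rw [map_pow, conj_q F, ← pow_add, Nat.add_sub_cancel' β.N_le]
        simp
      · rw [ih β' h', mul_zero]
    | char β' χ => rw [v_zero, E.v, innerPi_combination_lamMu]
  | @one n β ih =>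
    cases α' with
    | zero β' =>
      rw [v_zero, v_one, innerPi_combination]
      by_cases h' : β = β'
      · subst h'
        rw [map_pow, conj_q F, ← pow_add, Nat.sub_add_cancel β.N_le]
        simp
      · rw [ih β' h', mul_zero]
    | one β' =>
      rw [v_one, v_one, innerPi_combination, ih β' fun h' => h (h' ▸ rfl), mul_zero]
    | char β' χ => rw [v_one, E.v, innerPi_combination_lamMu]
  | @char n β χ ih =>
    cases α' with
    | zero β' => rw [v_zero, E.v, innerPi_lamMu_combination]
    | one β' => rw [v_one, E.v, innerPi_lamMu_combination]
    | char β' χ' =>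
      rw [E.v, E.v, innerPi_lamMu_lamMu]
      split_ifs with h'
      · subst h'
        rw [ih β' fun h' => h (h' ▸ rfl), mul_zero]
      · rfl

theorem linearIndependent_v : LinearIndependent ℂ fun α : E F n => α.v := by
  rw [linearIndependent_iff']
  intro s g hg α hα
  have h : innerPi α.v (∑ β ∈ s, g β • β.v) = ∑ β ∈ s, g β * innerPi α.v β.v := by
    simp_rw [← innerPi_smul_right]
    exact map_sum (AddMonoidHom.mk' (innerPi α.v) (innerPi_add_right α.v)) _ _
  rw [hg, Finset.sum_eq_single_of_mem α hα fun β _ hβ => by rw [innerPi_v_v _ _ hβ.symm, mul_zero]]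
    at h
  refine (mul_eq_zero.1 (h.symm.trans ?_)).resolve_right (innerPi_v_self_ne_zero α)
  simp [innerPi]

/-! ### Spanning. -/

lemma map_mem_of_span_eq_top {m : ℕ} {S : Submodule ℂ (V F m)} (f : V F n →ₗ[ℂ] V F m)
    (hn : Submodule.span ℂ (Set.range fun β : E F n => β.v) = ⊤) (h : ∀ β : E F n, f β.v ∈ S)
    (u : V F n) : f u ∈ S := by
  have h1 : (⊤ : Submodule ℂ (V F n)) ≤ S.comap f := by
    rw [← hn, Submodule.span_le]
    rintro _ ⟨β, rfl⟩
    exact h β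
  exact h1 (Submodule.mem_top (x := u))

lemma vec_mem_of_forall_twist_mem {S : Submodule ℂ (V F (n + 1))}
    (h1 : ∀ u, incl F n u ∈ S) (h2 : ∀ u, theta F n u ∈ S)
    (h3 : ∀ χ : AddChar (Fin n → F) ℂ, χ ≠ 1 → ∀ W, Triv χ W → twist χ (vec W) ∈ S) : S = ⊤ := by
  have hvec (X : B F (n + 1)) : vec X ∈ S := by
    obtain ⟨W, rfl⟩ | ⟨a, W, rfl⟩ := eq_map_emb_or_eq_slant X
    · have := h1 (vec W)
      rwa [incl, vec, Fintype.linearCombination_apply_single, one_smul] at this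
    · rw [vec_slant_eq_sum_twist]
      refine S.smul_mem _ (S.sum_mem fun χ _ => S.smul_mem _ ?_)
      by_cases hχ : χ = 1
      · rw [hχ, ← theta_eq_twist]
        exact h2 _
      · by_cases hW : Triv χ W
        · exact h3 χ hχ W hW
        · rw [not_ne_iff.1 (mt (twist_vec_ne_zero_iff χ W).1 hW)]
          exact S.zero_mem
  rw [eq_top_iff, ← (Pi.basisFun ℂ (B F (n + 1))).span_eq, Submodule.span_le]
  rintro _ ⟨X, rfl⟩
  rw [Pi.basisFun_apply]
  exact hvec X

lemma span_v_succ (hn : Submodule.span ℂ (Set.range fun α : E F n => α.v) = ⊤)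
    (hn' : ∀ k, n = k + 1 → Submodule.span ℂ (Set.range fun α : E F k => α.v) = ⊤) :
    Submodule.span ℂ (Set.range fun α : E F (n + 1) => α.v) = ⊤ := by
  set S := Submodule.span ℂ (Set.range fun α : E F (n + 1) => α.v)
  have hv (α : E F (n + 1)) : α.v ∈ S := Submodule.subset_span ⟨α, rfl⟩
  clear_value S
  have hincl (β : E F n) : incl F n β.v ∈ S := by
    -- In the sum of the two extensions of β the `theta` parts cancel, leaving a nonzero multiple of
    -- the `incl` part.
    have h := S.add_mem (hv (.zero β)) (hv (.one β))
    have h' : (E.zero β).v + (E.one β).v = (q F ^ β.N + q F ^ (n - β.N)) • incl F n β.v := by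
      simp only [E.v]
      module
    rw [h'] at h
    refine (S.smul_mem_iff ?_).1 h
    have := Fintype.card_pos (α := F)
    unfold q
    exact_mod_cast (by positivity : Fintype.card F ^ β.N + Fintype.card F ^ (n - β.N) ≠ 0)
  have htheta (β : E F n) : theta F n β.v ∈ S := by
    have h := S.sub_mem (hv (.zero β)) (S.smul_mem (q F ^ β.N) (hincl β))
    rwa [E.v, add_sub_cancel_left] at h
  refine vec_mem_of_forall_twist_mem (map_mem_of_span_eq_top _ hn hincl)
    (map_mem_of_span_eq_top _ hn htheta) fun χ hχ W hW => ?_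
  cases n with
  -- The zero space has no nontrivial character.
  | zero => exact absurd (by ext x; rw [Subsingleton.elim x 0, AddChar.map_zero_eq_one, AddChar.map_zero_eq_one]) hχ
  | succ k =>
    -- Since χ is trivial on W, W is the image under `tau` of a subspace of F^k, so the span two
    -- levels down applies.
    have h := map_mem_of_span_eq_top (S := S) (lamMu ⟨χ, hχ⟩) (hn' k rfl)
      (fun β => hv (.char β ⟨χ, hχ⟩)) (vec (W.comap (tau ⟨χ, hχ⟩)))
    rwa [lamMu_eq, push_vec,
      Submodule.map_comap_eq_of_le (((tau_spec ⟨χ, hχ⟩).2 W).1 hW)] at h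

theorem span_v : ∀ n : ℕ, Submodule.span ℂ (Set.range fun α : E F n => α.v) = ⊤
  | 0 => by
    rw [eq_top_iff]
    intro u _
    have h (X : B F 0) : X = ⊥ := Subsingleton.elim _ _
    have : u = u ⊥ • (E.nil : E F 0).v := by
      ext X
      simp [E.v, vec_apply, h X]
    rw [this]
    exact Submodule.smul_mem _ _ (Submodule.subset_span ⟨_, rfl⟩)
  | 1 => span_v_succ (span_v 0) (by simp)
  | n + 2 => span_v_succ (span_v (n + 1)) fun k hk => by
    obtain rfl : n = k := by omega
    exact span_v n

end Eigenbasis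

end QCube

end

theorem theorem10 (F : Type*) [Field F] [Fintype F] (n : ℕ) :
    ∃ b : Module.Basis (QCube.E F n) ℂ (QCube.V F n),
      (∀ α : QCube.E F n, b α = α.v) ∧
      (∀ α : QCube.E F n, (QCube.Mq F n).mulVec α.v =
        (QCube.qInt F (n - α.N) - QCube.qInt F α.N) • α.v) ∧
      ∀ α β : QCube.E F n, α ≠ β → QCube.innerPi α.v β.v = 0 :=
  ⟨Module.Basis.mk QCube.linearIndependent_v (QCube.span_v n).ge,
    fun _ => Module.Basis.mk_apply _ _ _, QCube.mulVec_v, QCube.innerPi_v_v⟩
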